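/- Let $G,H$ be finite alphabets and let $f:S\to H$, $S\subseteq G^n$, be a non-constant partial function; write $[n]$ for the set of positions. Define the following quantities (with $1/0=\infty$). - $\mathrm{fbs}(f)=\max_{x\in S}\mathrm{fbs}(f,x)$, where, with $\mathcal B_x=\{\{i: x_i\ne y_i\} : y\in S,\ f(y)\neq f(x)\}$, $\mathrm{fbs}(f,x)$ is the maximum of $\sum_{B\in\mathcal B_x}w(B)$ over $w:\mathcal B_x\to[0,1]$ with $\sum_{B\in\mathcal B_x,\,B\ni i}w(B)\le 1$ for all $i\in[n]$. - For $R:S\times S\to\mathbb R_{\ge0}$ let $\theta_R(x,i)=\sum_{y\in S}R(x,y)\big/\sum_{y\in S:\,x_i\ne y_i}R(x,y)$. Then $\mathrm{CA}(f)=\sup_R\min\max\{\theta_R(x,i),\theta_R(y,i)\}$, where the supremum is over symmetric $R\not\equiv0$ with $R(x,y)=0$ whenever $f(x)=f(y)$, and the minimum is over $x,y\in S$, $i\in[n]$ with $R(x,y)>0$, $x_i\neq y_i$. - $\mathrm{CA}_1(f)$ is defined in the same way, with $R$ restricted to $R(x,y)=\max\{u(x)v(y),u(y)v(x)\}$ for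 $u,v:S\to\mathbb R_{\ge0}$ such that $u(x)v(y)$ is not identically zero and vanishes whenever $f(x)=f(y)$; the minimum is over $x,y\in S$, $i\in[n]$ with $u(x)v(y)>0$, $x_i\ne y_i$. - $\mathrm{WA}(f)=\sup_{w,w'}\min\max\{wt(x)/v(x,i),\,wt(y)/v(y,i)\}$, where $w:S^2\to\mathbb R_{\ge0}$ is symmetric, not identically zero, and $w(x,y)=0$ whenever $f(x)=f(y)$; $w':S^2\times[n]\to\mathbb R_{\ge0}$ satisfies $w'(x,y,i)=0$ whenever $x_i=y_i$ or $f(x)=f(y)$, and $w'(x,y,i),w'(y,x,i)\ge w(x,y)$ whenever $x_i\ne y_i$; $wt(x)=\sum_y w(x,y)$, $v(x,i)=\sum_y w'(x,y,i)$; and the minimum is over $x,y\in S$, $i\in[n]$ with $w(x,y)\ne0$, $x_i\neq y_i$. - $\mathrm{MM}(f)=\inf_p\max_{x,y\in S:\,f(x)\ne f(y)}\dfrac1{\sum_{i:\,x_i\ne y_i}\min\{p_x(i),p_y(i)\}}$, where $p=\{p_x\}_{x\in S}$ is a family of probability distributions on $[n]$. - Fix a universal prefix machine $U$: a partial computable function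 $U(P,y)$ of a program $P\in\{0,1\}^*$ and a condition $y$ such that for every $y$ no halting program is a proper prefix of another, and which is additively optimal, that is, for $K_U(x|y)=\min\{|P|:U(P,y)=x\}$ and every other such machine $V$ there is a constant $c$ with $K_U(x|y)\le K_V(x|y)+c$ for all $x,y$. Write $K=K_U$ and $\mathrm{KA}(f)=\inf_{\sigma\in\{0,1\}^*}\max_{x,y\in S:\,f(x)\ne f(y)}\dfrac1{\sum_{i:\,x_i\ne y_i}\min\{2^{-K(i|x,\sigma)},2^{-K(i|y,\sigma)}\}}$, where the letters of $G$ are numbered arbitrarily to present $x$ to $U$. Then $$\mathrm{fbs}(f)\le \mathrm{CA}_1(f)\le \mathrm{CA}(f)=\mathrm{WA}(f),\qquad \mathrm{WA}(f)=O(\mathrm{KA}(f)),\qquad \mathrm{KA}(f)=\Theta(\mathrm{MM}(f)),$$ where the implied constants depend only on $U$ (not on $n$, $G$, $H$, $S$, $f$ or the numbering of $G$). If moreover $f$ is total, i.e. $S=G^n$, then $$\mathrm{fbs}(f)=\mathrm{MM}(f),$$ and hence $\mathrm{WA}(f)=O(\mathrm{fbs}(f))$ and $\mathrm{KA}(f)=\Theta(\mathrm{fbs}(f))$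 with constants depending only on $U$, so that all these bounds are equivalent to $\mathrm{fbs}(f)$. -/

import Mathlib

open scoped NNReal ENNReal

universe u v

namespace ClassicalAdversary

noncomputable section

variable {n : ℕ} {G : Type u} {H : Type v} {S : Finset (Fin n → G)}

/-! A partial function on words of length `n` over the alphabet `G` is a map `f : S → H`, where
`S ⊆ Gⁿ`. All measures take values in `[0, ∞]`, so that suprema, infima and `1 / 0 = ∞` have their
usual meaning. -/

/-- The set of positions at which two inputs differ. -/
def diff (x y : S) : Finset (Fin n) :=
  open Classical in Finset.univ.filter fun i => x.1 i ≠ y.1 i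

/-! ### Fractional block sensitivity -/

/-- The set of sensitive blocks of `x`. -/
def sensitiveBlocks (f : S → H) (x : S) : Finset (Finset (Fin n)) :=
  open Classical in Finset.univ.filter fun B => ∃ y : S, f x ≠ f y ∧ B = diff x y

/-- `w` is a feasible solution of the linear program for `fbs(f, x)`
(only the values of `w` on the sensitive blocks matter). -/
def IsBlockPacking (f : S → H) (x : S) (w : Finset (Fin n) → ℝ≥0) : Prop :=
  (∀ B ∈ sensitiveBlocks f x, w B ≤ 1) ∧
    ∀ i : Fin n, ∑ B ∈ sensitiveBlocks f x with i ∈ B, w B ≤ 1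

/-- Fractional block sensitivity of `f` on the input `x`. -/
def fbsAt (f : S → H) (x : S) : ℝ≥0∞ :=
  ⨆ (w : Finset (Fin n) → ℝ≥0) (_ : IsBlockPacking f x w),
    ((∑ B ∈ sensitiveBlocks f x, w B : ℝ≥0) : ℝ≥0∞)

/-- Fractional block sensitivity of `f`. -/
def fbs (f : S → H) : ℝ≥0∞ := ⨆ x : S, fbsAt f x

/-! ### Relational adversary bound -/

/-- `θ(x, i)`, the quotient of `∑ y, R x y` by the sum of `R x y` over all `y` with `x i ≠ y i`
(only used where the denominator is positive). -/
def theta (R : S → S → ℝ≥0) (x : S) (i : Fin n) : ℝ≥0∞ :=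
  open Classical in
  ((∑ y : S, R x y : ℝ≥0) : ℝ≥0∞) / ((∑ y : S with x.1 i ≠ y.1 i, R x y : ℝ≥0) : ℝ≥0∞)

/-- Admissible relations: symmetric, vanishing on pairs with equal function values,
and not identically zero. -/
structure IsRelation (f : S → H) (R : S → S → ℝ≥0) : Prop where
  symm : ∀ x y, R x y = R y x
  zero : ∀ x y, f x = f y → R x y = 0
  ne_zero : ∃ x y, R x y ≠ 0

/-- Relational adversary bound. -/
def CA (f : S → H) : ℝ≥0∞ :=
  ⨆ (R : S → S → ℝ≥0) (_ : IsRelation f R),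
    ⨅ (x : S) (y : S) (i : Fin n) (_ : 0 < R x y) (_ : x.1 i ≠ y.1 i),
      max (theta R x i) (theta R y i)

/-! ### Rank-1 relational adversary bound -/

/-- `R'(x, y) = u(x) v(y)` has rank 1 and vanishes on pairs with equal function values. -/
structure IsRankOne (f : S → H) (u v : S → ℝ≥0) : Prop where
  zero : ∀ x y, f x = f y → u x * v y = 0
  ne_zero : ∃ x y, u x * v y ≠ 0

/-- `R(x, y) = max (R'(x, y)) (R'(y, x))` for `R'(x, y) = u(x) v(y)`. -/
def rankOneRel (u v : S → ℝ≥0) (x y : S) : ℝ≥0 := max (u x * v y) (u y * v x)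

/-- Rank-1 relational adversary bound. -/
def CA₁ (f : S → H) : ℝ≥0∞ :=
  ⨆ (u : S → ℝ≥0) (v : S → ℝ≥0) (_ : IsRankOne f u v),
    ⨅ (x : S) (y : S) (i : Fin n) (_ : 0 < u x * v y) (_ : x.1 i ≠ y.1 i),
      max (theta (rankOneRel u v) x i) (theta (rankOneRel u v) y i)

/-! ### Weighted adversary bound -/

/-- Weight schemes `w, w'`, with `w` not identically zero. -/
structure IsWeightScheme (f : S → H) (w : S → S → ℝ≥0) (w' : S → S → Fin n → ℝ≥0) : Prop where
  symm : ∀ x y, w x y = w y x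
  zero : ∀ x y, f x = f y → w x y = 0
  ne_zero : ∃ x y, w x y ≠ 0
  zero' : ∀ x y i, x.1 i = y.1 i ∨ f x = f y → w' x y i = 0
  le_left : ∀ x y i, x.1 i ≠ y.1 i → w x y ≤ w' x y i
  le_right : ∀ x y i, x.1 i ≠ y.1 i → w x y ≤ w' y x i

/-- The quotient `wt(x) / v(x, i)` (only used where `v(x, i)` is positive). -/
def weightRatio (w : S → S → ℝ≥0) (w' : S → S → Fin n → ℝ≥0) (x : S) (i : Fin n) : ℝ≥0∞ :=
  ((∑ y : S, w x y : ℝ≥0) : ℝ≥0∞) / ((∑ y : S, w' x y i : ℝ≥0) : ℝ≥0∞)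

/-- Weighted adversary bound. -/
def WA (f : S → H) : ℝ≥0∞ :=
  ⨆ (w : S → S → ℝ≥0) (w' : S → S → Fin n → ℝ≥0) (_ : IsWeightScheme f w w'),
    ⨅ (x : S) (y : S) (i : Fin n) (_ : w x y ≠ 0) (_ : x.1 i ≠ y.1 i),
      max (weightRatio w w' x i) (weightRatio w w' y i)

/-! ### Minimax over probability distributions -/

/-- Minimax over probability distributions; `p x` is a probability distribution on the positions
for every input `x`. -/
def MM (f : S → H) : ℝ≥0∞ :=
  ⨅ (p : S → Fin n → ℝ≥0) (_ : ∀ x, ∑ i, p x i = 1),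
    ⨆ (x : S) (y : S) (_ : f x ≠ f y),
      1 / ((∑ i ∈ diff x y, min (p x i) (p y i) : ℝ≥0) : ℝ≥0∞)

/-! ### Prefix-free Kolmogorov complexity and the Kolmogorov complexity bound

Programs are binary strings. Outputs and conditions are finite objects, represented by their
codes in `ℕ` (`Encodable.encode`). -/

/-- A set of binary strings none of which is a proper prefix of another. -/
def PrefixFree (A : Set (List Bool)) : Prop :=
  ∀ p ∈ A, ∀ q ∈ A, p <+: q → p = q

/-- A prefix machine: a partial computable function of a program and a condition such that, for
every condition, the set of halting programs is prefix-free. -/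
structure IsPrefixMachine (U : List Bool → ℕ →. ℕ) : Prop where
  partrec : Partrec₂ U
  prefixFree : ∀ y, PrefixFree {p | (U p y).Dom}

/-- `K_U(x | y)`: the length of a shortest program that prints `x` when given `y`
(`∞` if there is none). -/
def prefixComplexity (U : List Bool → ℕ →. ℕ) (x y : ℕ) : ℕ∞ :=
  ⨅ (p : List Bool) (_ : x ∈ U p y), (p.length : ℕ∞)

/-- A universal (additively optimal) prefix machine: its complexity is, up to an additive constant,
at most that of every other prefix machine. -/
structure IsUniversalPrefixMachine (U : List Bool → ℕ →. ℕ) : Prop where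
  isPrefixMachine : IsPrefixMachine U
  optimal : ∀ V, IsPrefixMachine V →
    ∃ c : ℕ, ∀ x y, prefixComplexity U x y ≤ prefixComplexity V x y + c

/-- `2 ^ (-k)`, with `2 ^ (-∞) = 0`. -/
def twoPowNeg (k : ℕ∞) : ℝ≥0∞ := ENat.recTopCoe 0 (fun m : ℕ => (2⁻¹ : ℝ≥0∞) ^ m) k

/-- `K(i | x, σ)`: the condition is the pair of the input `x`, as the list of its letters, and `σ`.
The letters of `G` are numbered by the `Encodable` instance. -/
def K [Encodable G] (U : List Bool → ℕ →. ℕ) (i : Fin n) (x : S) (σ : List Bool) : ℕ∞ :=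
  prefixComplexity U (i : ℕ)
    (Encodable.encode ((List.ofFn fun j => Encodable.encode (x.1 j), σ) : List ℕ × List Bool))

/-- Kolmogorov complexity adversary bound, with respect to the machine `U`. -/
def KA [Encodable G] (U : List Bool → ℕ →. ℕ) (f : S → H) : ℝ≥0∞ :=
  ⨅ σ : List Bool, ⨆ (x : S) (y : S) (_ : f x ≠ f y),
    1 / ∑ i ∈ diff x y, min (twoPowNeg (K U i x σ)) (twoPowNeg (K U i y σ))

end

end ClassicalAdversary

namespace ClassicalAdversary

/-! ### Relational, weighted and rank-one bounds, and their comparison with minimax -/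

section Relations

variable {n : ℕ} {G : Type u} {H : Type v} {S : Finset (Fin n → G)}

/-! Every bound is compared with `familyValue`, the reciprocal of the least overlap of weights
attached to two inputs with different values. The chain is fbs ≤ CA₁ ≤ CA = WA ≤ 2 MM, together with
MM ≤ KA ≤ 2^(d+1) MM.

For fbs ≤ CA₁, a block packing at `x` becomes a star-shaped relation centred at `x`. CA = WA because
`w'` is best chosen minimal. CA ≤ 2 MM (`CA_le_two_mul_familyValue`) is a double count: at each
differing position one endpoint has large θ, and the overlap is charged to it.

Kraft's inequality makes the weights 2^(-K) subprobabilities, so MM ≤ KA. Conversely, Shannon codes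
for any family of distributions are stored in σ and read by one fixed prefix machine
(`exists_condition_for_family`), so universality costs only a constant.

For total f, linear programming duality gives each input a distribution of mass at least 1/fbs on
all its sensitive blocks. A hybrid of two inputs turns these masses into overlap
(`MM_le_fbs_of_total`). -/

theorem mem_diff {x y : S} {i : Fin n} : i ∈ diff x y ↔ x.1 i ≠ y.1 i := by
  simp [diff]

theorem mem_sensitiveBlocks {f : S → H} {x : S} {B : Finset (Fin n)} :
    B ∈ sensitiveBlocks f x ↔ ∃ y : S, f x ≠ f y ∧ B = diff x y := by
  simp [sensitiveBlocks]

theorem diff_nonempty_of_ne {f : S → H} {x y : S} (h : f x ≠ f y) : (diff x y).Nonempty := by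
  by_contra hne
  rw [Finset.not_nonempty_iff_eq_empty] at hne
  refine h (congrArg f (Subtype.ext (funext fun i => ?_)))
  by_contra hi
  simpa [hne] using mem_diff.2 hi

/-! ### The relational and the weighted adversary bounds coincide -/

theorem CA_le_WA (f : S → H) : CA f ≤ WA f := by
  classical
  refine iSup₂_le fun R hR => ?_
  let w' : S → S → Fin n → ℝ≥0 := fun x y i => if x.1 i ≠ y.1 i then R x y else 0
  have hw : IsWeightScheme f R w' :=
    { symm := hR.symm
      zero := hR.zero
      ne_zero := hR.ne_zero
      zero' := by
        rintro x y i (h | h)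
        · simp [w', h]
        · simp [w', hR.zero x y h]
      le_left := fun x y i h => by simp [w', h]
      le_right := fun x y i h => by simp [w', h.symm, hR.symm x y] }
  refine le_trans ?_ (le_iSup_of_le R (le_iSup₂_of_le w' hw le_rfl))
  refine le_iInf fun x => le_iInf fun y => le_iInf fun i => le_iInf fun h => le_iInf fun hi => ?_
  refine (iInf_le_of_le x <| iInf_le_of_le y <| iInf_le_of_le i <|
    iInf_le_of_le (pos_iff_ne_zero.2 h) <| iInf_le_of_le hi le_rfl).trans (le_of_eq ?_)
  have key : ∀ z : S, theta R z i = weightRatio R w' z i := by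
    intro z
    simp only [theta, weightRatio, w', Finset.sum_filter]
  rw [key, key]

/-- Since `w'` dominates `w` where the letters differ, v(x, i) is at least the denominator of θ: a
general `w'` gains nothing over the truncation of `w`. -/
theorem weightRatio_le_theta {f : S → H} {w : S → S → ℝ≥0} {w' : S → S → Fin n → ℝ≥0}
    (hw : IsWeightScheme f w w') (x : S) (i : Fin n) : weightRatio w w' x i ≤ theta w x i := by
  classical
  refine ENNReal.div_le_div le_rfl (ENNReal.coe_le_coe.2 ?_)
  rw [Finset.sum_filter]
  refine Finset.sum_le_sum fun y _ => ?_
  split_ifs with h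
  · exact hw.le_left x y i h
  · exact zero_le

theorem WA_le_CA (f : S → H) : WA f ≤ CA f := by
  refine iSup_le fun w => iSup₂_le fun w' hw => ?_
  refine le_trans ?_ (le_iSup₂_of_le w ⟨hw.symm, hw.zero, hw.ne_zero⟩ le_rfl)
  refine le_iInf fun x => le_iInf fun y => le_iInf fun i => le_iInf fun h => le_iInf fun hi => ?_
  exact (iInf_le_of_le x <| iInf_le_of_le y <| iInf_le_of_le i <|
    iInf_le_of_le h.ne' <| iInf_le_of_le hi le_rfl).trans
    (max_le_max (weightRatio_le_theta hw x i) (weightRatio_le_theta hw y i))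

theorem CA_eq_WA (f : S → H) : CA f = WA f := le_antisymm (CA_le_WA f) (WA_le_CA f)

/-! ### The rank-one bound -/

theorem rankOneRel_comm (u v : S → ℝ≥0) (x y : S) : rankOneRel u v x y = rankOneRel u v y x :=
  max_comm _ _

theorem IsRankOne.isRelation {f : S → H} {u v : S → ℝ≥0} (h : IsRankOne f u v) :
    IsRelation f (rankOneRel u v) where
  symm := rankOneRel_comm u v
  zero x y hxy := by simp only [rankOneRel, h.zero x y hxy, h.zero y x hxy.symm, max_self]
  ne_zero := by
    obtain ⟨x, y, hxy⟩ := h.ne_zero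
    exact ⟨x, y, (lt_max_of_lt_left (pos_iff_ne_zero.2 hxy)).ne'⟩

theorem CA₁_le_CA (f : S → H) : CA₁ f ≤ CA f := by
  refine iSup_le fun u => iSup₂_le fun v h => ?_
  refine le_trans ?_ (le_iSup₂_of_le (rankOneRel u v) h.isRelation le_rfl)
  refine le_iInf fun x => le_iInf fun y => le_iInf fun i => le_iInf fun hR => le_iInf fun hi => ?_
  rcases lt_max_iff.1 hR with hxy | hyx
  · exact iInf_le_of_le x <| iInf_le_of_le y <| iInf_le_of_le i <|
      iInf_le_of_le hxy <| iInf_le_of_le hi le_rfl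
  · rw [max_comm]
    exact iInf_le_of_le y <| iInf_le_of_le x <| iInf_le_of_le i <|
      iInf_le_of_le hyx <| iInf_le_of_le hi.symm le_rfl

/-- A weight function on the sensitive blocks of `x` can be carried over to the inputs, such that
the weight of every sensitive block is carried by a single input. -/
theorem exists_weight_on_inputs (f : S → H) (x : S) (w : Finset (Fin n) → ℝ≥0) :
    ∃ v : S → ℝ≥0, (∀ y, f x = f y → v y = 0) ∧
      ∀ P : Finset (Fin n) → Prop, ∀ [DecidablePred P],
        ∑ y : S with P (diff x y), v y = ∑ B ∈ sensitiveBlocks f x with P B, w B := by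
  classical
  have hex : ∀ B : Finset (Fin n), ∃ y : S, B ∈ sensitiveBlocks f x → f x ≠ f y ∧ B = diff x y := by
    intro B
    by_cases hB : B ∈ sensitiveBlocks f x
    · obtain ⟨y, hy⟩ := mem_sensitiveBlocks.1 hB
      exact ⟨y, fun _ => hy⟩
    · exact ⟨x, fun h => absurd h hB⟩
  choose g hg using hex
  -- Several inputs may induce the same block; only the representative chosen by `g` carries its
  -- weight, so no block is counted twice.
  refine ⟨fun y => if f x ≠ f y ∧ g (diff x y) = y then w (diff x y) else 0,
    fun y hy => by simp [hy], fun P _ => ?_⟩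
  rw [← Finset.sum_filter, Finset.filter_filter]
  refine Finset.sum_nbij' (fun y => diff x y) g ?_ ?_ ?_ ?_ (fun _ _ => rfl)
  · intro y hy
    simp only [Finset.mem_filter, Finset.mem_univ, true_and] at hy
    exact Finset.mem_filter.2 ⟨mem_sensitiveBlocks.2 ⟨y, hy.2.1, rfl⟩, hy.1⟩
  · intro B hB
    obtain ⟨hB, hP⟩ := Finset.mem_filter.1 hB
    obtain ⟨h1, h2⟩ := hg B hB
    simp only [Finset.mem_filter, Finset.mem_univ, true_and]
    rw [← h2]
    exact ⟨hP, h1, rfl⟩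
  · intro y hy
    simp only [Finset.mem_filter, Finset.mem_univ, true_and] at hy
    exact hy.2.2
  · intro B hB
    exact (hg B (Finset.mem_filter.1 hB).1).2.symm

theorem fbs_le_CA₁ (f : S → H) : fbs f ≤ CA₁ f := by
  classical
  refine iSup_le fun x => iSup₂_le fun w hw => ?_
  obtain ⟨v, hv0, hv⟩ := exists_weight_on_inputs f x w
  have htot : ∑ y : S, v y = ∑ B ∈ sensitiveBlocks f x, w B := by
    simpa using hv fun _ => True
  rcases eq_or_ne (∑ B ∈ sensitiveBlocks f x, w B) 0 with h0 | h0
  · rw [h0]; exact zero_le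
  -- The relation is a star centred at `x`: the numerator of θ(x, i) is the packing total, and its
  -- denominator is at most 1 by the packing constraint at `i`.
  let u : S → ℝ≥0 := fun y => if y = x then 1 else 0
  have hR : ∀ y, rankOneRel u v x y = v y := by
    intro y
    simp [rankOneRel, u, hv0 x rfl]
  have hu : IsRankOne f u v :=
    { zero := fun a b hab => by
        by_cases ha : a = x
        · subst ha; simp [hv0 b hab]
        · simp [u, ha]
      ne_zero := by
        rw [← htot] at h0
        obtain ⟨y, -, hy⟩ := Finset.exists_ne_zero_of_sum_ne_zero h0
        exact ⟨x, y, by simpa [u] using hy⟩ }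
  refine le_iSup_of_le u <| le_iSup₂_of_le v hu ?_
  refine le_iInf fun a => le_iInf fun b => le_iInf fun i => le_iInf fun hab => le_iInf fun hi => ?_
  have ha : a = x := by
    by_contra ha
    simp [u, ha] at hab
  subst ha
  refine le_max_of_le_left ?_
  have hden : (∑ y : S with a.1 i ≠ y.1 i, rankOneRel u v a y) ≤ 1 := by
    simp only [hR]
    calc _ = ∑ y : S with i ∈ diff a y, v y := by simp only [mem_diff]
      _ ≤ 1 := (hv fun B => i ∈ B).trans_le (hw.2 i)
  have hnum : (∑ y : S, rankOneRel u v a y) = ∑ B ∈ sensitiveBlocks f a, w B := by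
    simp only [hR, htot]
  calc ((∑ B ∈ sensitiveBlocks f a, w B : ℝ≥0) : ℝ≥0∞)
      = ((∑ y : S, rankOneRel u v a y : ℝ≥0) : ℝ≥0∞) / 1 := by rw [hnum, div_one]
    _ ≤ theta (rankOneRel u v) a i :=
        ENNReal.div_le_div le_rfl (by exact_mod_cast hden)

/-! ### The minimax bound dominates the relational bound up to a factor of two -/

/-- The value of a family `q` of weights on the positions: the objective minimised in the minimax
bounds. -/
noncomputable def familyValue (f : S → H) (q : S → Fin n → ℝ≥0∞) : ℝ≥0∞ :=
  ⨆ (x : S) (y : S) (_ : f x ≠ f y), 1 / ∑ i ∈ diff x y, min (q x i) (q y i)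

theorem MM_eq_iInf_familyValue (f : S → H) :
    MM f = ⨅ (p : S → Fin n → ℝ≥0) (_ : ∀ x, ∑ i, p x i = 1),
      familyValue f fun x i => (p x i : ℝ≥0∞) := by
  simp only [MM, familyValue, ENNReal.ofNNReal_finsetSum, ENNReal.coe_min]

theorem KA_eq_iInf_familyValue [Encodable G] (U : List Bool → ℕ →. ℕ) (f : S → H) :
    KA U f = ⨅ σ : List Bool, familyValue f fun x i => twoPowNeg (K U i x σ) := rfl

theorem one_div_le_familyValue {f : S → H} (q : S → Fin n → ℝ≥0∞) {x y : S} (h : f x ≠ f y) :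
    1 / ∑ i ∈ diff x y, min (q x i) (q y i) ≤ familyValue f q :=
  le_iSup_of_le x <| le_iSup₂_of_le y h le_rfl

/-- Overlaps are monotone and homogeneous in the weights, so their reciprocals scale by at most `c`.
-/
theorem familyValue_le_mul {f : S → H} {q q' : S → Fin n → ℝ≥0∞} {c : ℝ≥0∞} (hc : c ≠ 0)
    (hc' : c ≠ ⊤) (h : ∀ x i, q x i ≤ c * q' x i) : familyValue f q' ≤ c * familyValue f q := by
  refine iSup_le fun x => iSup₂_le fun y hxy => ?_
  refine le_trans ?_ (mul_le_mul_right (one_div_le_familyValue q hxy) c)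
  have hs : ∑ i ∈ diff x y, min (q x i) (q y i)
      ≤ c * ∑ i ∈ diff x y, min (q' x i) (q' y i) := by
    rw [Finset.mul_sum]
    refine Finset.sum_le_sum fun i _ => ?_
    rw [mul_min]
    exact min_le_min (h x i) (h y i)
  calc 1 / ∑ i ∈ diff x y, min (q' x i) (q' y i)
      = c * (1 / (c * ∑ i ∈ diff x y, min (q' x i) (q' y i))) := by
        rw [one_div, one_div, ENNReal.mul_inv (Or.inl hc) (Or.inl hc'), ← mul_assoc,
          ENNReal.mul_inv_cancel hc hc', one_mul]
    _ ≤ _ := mul_le_mul_right (ENNReal.div_le_div le_rfl hs) c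

theorem one_le_familyValue_mul {f : S → H} {q : S → Fin n → ℝ≥0∞} (hq : ∀ x, ∑ i, q x i ≤ 1)
    (hM : familyValue f q ≠ ⊤) {x y : S} (h : f x ≠ f y) :
    1 ≤ familyValue f q * ∑ i ∈ diff x y, min (q x i) (q y i) := by
  have hs : ∑ i ∈ diff x y, min (q x i) (q y i) ≤ 1 :=
    (Finset.sum_le_sum fun i _ => min_le_left _ _).trans
      ((Finset.sum_le_sum_of_subset (Finset.subset_univ _)).trans (hq x))
  have hle := one_div_le_familyValue q h
  have hs0 : ∑ i ∈ diff x y, min (q x i) (q y i) ≠ 0 := by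
    intro h0
    rw [h0, ENNReal.div_zero one_ne_zero] at hle
    exact hM (top_le_iff.1 hle)
  exact (ENNReal.div_le_iff_le_mul (Or.inl hs0)
    (Or.inl (hs.trans_lt ENNReal.one_lt_top).ne)).1 hle

theorem CA_le_two_mul_familyValue (f : S → H) (q : S → Fin n → ℝ≥0∞)
    (hq : ∀ x, ∑ i, q x i ≤ 1) : CA f ≤ 2 * familyValue f q := by
  classical
  refine iSup₂_le fun R hR => ?_
  set A : ℝ≥0∞ := ⨅ (x : S) (y : S) (i : Fin n) (_ : 0 < R x y) (_ : x.1 i ≠ y.1 i),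
      max (theta R x i) (theta R y i) with hA
  rcases eq_or_ne (familyValue f q) ⊤ with hM | hM
  · simp [hM]
  set M := familyValue f q
  let r : S → S → ℝ≥0∞ := fun x y => R x y
  have hr : ∀ x y, r x y = r y x := fun x y => congrArg _ (hR.symm x y)
  let T : ℝ≥0∞ := ∑ x, ∑ y, r x y
  -- The charge an endpoint accepts: nonzero only where its own θ reaches `A`. On every related pair
  -- and differing position at least one endpoint qualifies.
  let g : S → Fin n → ℝ≥0∞ := fun x i => if A ≤ theta R x i then A * q x i else 0
  have hmin : ∀ x y i, r x y * (if x.1 i ≠ y.1 i then A * min (q x i) (q y i) else 0)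
      ≤ (if x.1 i ≠ y.1 i then r x y * g x i else 0)
        + if y.1 i ≠ x.1 i then r y x * g y i else 0 := by
    intro x y i
    rcases eq_or_ne (R x y) 0 with h0 | h0
    · simp [r, h0]
    by_cases hi : x.1 i = y.1 i
    · simp [hi]
    have hAm : A ≤ max (theta R x i) (theta R y i) :=
      iInf_le_of_le x <| iInf_le_of_le y <| iInf_le_of_le i <|
        iInf_le_of_le (pos_iff_ne_zero.2 h0) <| iInf_le_of_le hi le_rfl
    rw [if_pos hi, if_pos hi, if_pos (Ne.symm hi), hr y x, ← mul_add]
    refine mul_le_mul_right ?_ _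
    rcases le_max_iff.1 hAm with h | h
    · exact (mul_le_mul_right (min_le_left _ _) A).trans
        (by simp only [g, if_pos h]; exact le_self_add)
    · exact (mul_le_mul_right (min_le_right _ _) A).trans
        (by simp only [g, if_pos h]; exact le_add_self)
  -- Where θ(x, i) ≥ A, the relation mass at `x` that differs at `i` is at most 1/A of the total
  -- there; averaging over `q x` keeps the charge below that total. Summing both endpoints' charges
  -- gives the factor 2.
  have hhalf : ∑ x, ∑ y, ∑ i, (if x.1 i ≠ y.1 i then r x y * g x i else 0) ≤ T := by
    refine Finset.sum_le_sum fun x _ => ?_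
    rw [Finset.sum_comm]
    have : ∀ i, ∑ y, (if x.1 i ≠ y.1 i then r x y * g x i else 0) ≤ q x i * ∑ y, r x y := by
      intro i
      rw [← Finset.sum_filter, ← Finset.sum_mul]
      by_cases h : A ≤ theta R x i
      · have h' : A * ∑ y with x.1 i ≠ y.1 i, r x y ≤ ∑ y, r x y := by
          have := ENNReal.mul_le_of_le_div h
          simp only [ENNReal.ofNNReal_finsetSum] at this
          convert this
        simp only [g, if_pos h]
        calc _ = q x i * (A * ∑ y with x.1 i ≠ y.1 i, r x y) := by ring
          _ ≤ _ := mul_le_mul_right h' _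
      · simp [g, h]
    refine (Finset.sum_le_sum fun i _ => this i).trans ?_
    rw [← Finset.sum_mul]
    exact (mul_le_mul_left (hq x) _).trans (one_mul _).le
  have hmain : A * T ≤ 2 * M * T := by
    calc A * T = ∑ x, ∑ y, A * r x y := by simp only [T, Finset.mul_sum]
      _ ≤ ∑ x, ∑ y, M * ∑ i, r x y *
            (if x.1 i ≠ y.1 i then A * min (q x i) (q y i) else 0) := by
          refine Finset.sum_le_sum fun x _ => Finset.sum_le_sum fun y _ => ?_
          by_cases hxy : f x = f y
          · simp [r, hR.zero x y hxy]
          have h1 := one_le_familyValue_mul hq hM hxy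
          have h2 : ∑ i, (if x.1 i ≠ y.1 i then A * min (q x i) (q y i) else 0)
              = A * ∑ i ∈ diff x y, min (q x i) (q y i) := by
            rw [← Finset.sum_filter, Finset.mul_sum]
            refine Finset.sum_congr ?_ fun _ _ => rfl
            ext i; simp [mem_diff]
          rw [← Finset.mul_sum, h2]
          calc A * r x y = A * r x y * 1 := (mul_one _).symm
            _ ≤ A * r x y * (M * ∑ i ∈ diff x y, min (q x i) (q y i)) := mul_le_mul_right h1 _
            _ = _ := by ring
      _ ≤ ∑ x, ∑ y, M * ∑ i, ((if x.1 i ≠ y.1 i then r x y * g x i else 0)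
            + if y.1 i ≠ x.1 i then r y x * g y i else 0) :=
          Finset.sum_le_sum fun x _ => Finset.sum_le_sum fun y _ =>
            mul_le_mul_right (Finset.sum_le_sum fun i _ => hmin x y i) _
      _ = M * (∑ x, ∑ y, ∑ i, (if x.1 i ≠ y.1 i then r x y * g x i else 0)
            + ∑ x, ∑ y, ∑ i, (if x.1 i ≠ y.1 i then r x y * g x i else 0)) := by
          simp only [← Finset.mul_sum, Finset.sum_add_distrib]
          congr 2
          exact Finset.sum_comm
      _ ≤ M * (T + T) := mul_le_mul_right (add_le_add hhalf hhalf) _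
      _ = 2 * M * T := by ring
  have hT0 : T ≠ 0 := by
    obtain ⟨x, y, hxy⟩ := hR.ne_zero
    intro h0
    have h1 := (Finset.sum_eq_zero_iff.1 h0) x (Finset.mem_univ _)
    have h2 := (Finset.sum_eq_zero_iff.1 h1) y (Finset.mem_univ _)
    exact hxy (by simpa [r] using h2)
  have hT : T ≠ ⊤ := by
    simp [T, r, ENNReal.sum_eq_top]
  exact (ENNReal.mul_le_mul_iff_left hT0 hT).1 hmain

theorem CA_le_two_mul_MM (f : S → H) : CA f ≤ 2 * MM f := by
  rw [MM_eq_iInf_familyValue, ENNReal.mul_iInf_of_ne two_ne_zero ENNReal.ofNat_ne_top]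
  refine le_iInf fun p => ?_
  rw [ENNReal.mul_iInf_of_ne two_ne_zero ENNReal.ofNat_ne_top]
  exact le_iInf fun hp => CA_le_two_mul_familyValue f _ fun x =>
    le_of_eq (by exact_mod_cast hp x)

end Relations

end ClassicalAdversary

/-- The **minimax theorem** for finite matrix games. -/
theorem Matrix.exists_optimal_strategies {α β : Type*} [Fintype α] [Fintype β] [Nonempty α]
    [Nonempty β] (A : Matrix α β ℝ) :
    ∃ q ∈ stdSimplex ℝ α, ∃ p ∈ stdSimplex ℝ β, ∃ c : ℝ,
      (∀ a, c ≤ ∑ b, A a b * p b) ∧ ∀ b, ∑ a, q a * A a b ≤ c := by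
  classical
  let φ : (α → ℝ) →ₗ[ℝ] (β → ℝ) →ₗ[ℝ] ℝ := Matrix.toLinearMap₂' ℝ A
  obtain ⟨q, hq, p, hp, h⟩ := Sion.exists_isSaddlePointOn
    (X := stdSimplex ℝ α) (Y := stdSimplex ℝ β) (f := fun x y => φ x y)
    ⟨_, single_mem_stdSimplex ℝ (Classical.arbitrary α)⟩
    (convex_stdSimplex ℝ α) (isCompact_stdSimplex ℝ α)
    (fun y _ => (φ.flip y).continuous_of_finiteDimensional.lowerSemicontinuous.lowerSemicontinuousOn _)
    (fun y _ => ((φ.flip y).convexOn (convex_stdSimplex ℝ α)).quasiconvexOn)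
    (convex_stdSimplex ℝ β) ⟨_, single_mem_stdSimplex ℝ (Classical.arbitrary β)⟩
    (isCompact_stdSimplex ℝ β)
    (fun x _ => (φ x).continuous_of_finiteDimensional.upperSemicontinuous.upperSemicontinuousOn _)
    (fun x _ => ((φ x).concaveOn (convex_stdSimplex ℝ β)).quasiconcaveOn)
  -- The saddle point is tested against pure strategies, the vertices of the simplices.
  refine ⟨q, hq, p, hp, φ q p, fun a => ?_, fun b => ?_⟩
  · have := h (Pi.single a 1) (single_mem_stdSimplex ℝ a) p hp
    simpa [φ, Matrix.toLinearMap₂'_apply', Matrix.mulVec, dotProduct, Pi.single_apply] using this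
  · have := h q hq (Pi.single b 1) (single_mem_stdSimplex ℝ b)
    simpa [φ, Matrix.toLinearMap₂'_apply', Matrix.mulVec, dotProduct, Pi.single_apply] using this

namespace ClassicalAdversary

/-! ### Linear programming duality and total functions -/

section MinimaxTotal

variable {n : ℕ} {G : Type u} {H : Type v} {S : Finset (Fin n → G)}

/-- Fractional block sensitivity never exceeds the minimax bound. -/
theorem fbs_le_MM (f : S → H) : fbs f ≤ MM f := by
  classical
  rw [MM_eq_iInf_familyValue]
  refine le_iInf₂ fun p hp => iSup_le fun x => iSup₂_le fun w hw => ?_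
  have hq : ∀ x, ∑ i, (p x i : ℝ≥0∞) ≤ 1 := fun x => le_of_eq (by exact_mod_cast hp x)
  rcases eq_or_ne (familyValue f fun x i => (p x i : ℝ≥0∞)) ⊤ with hM | hM
  · simp [hM]
  -- The scaled distribution M · p x is a fractional cover of the sensitive blocks; the rest is weak
  -- duality.
  have hB : ∀ B ∈ sensitiveBlocks f x,
      1 ≤ familyValue f (fun x i => (p x i : ℝ≥0∞)) * ∑ i ∈ B, (p x i : ℝ≥0∞) := by
    intro B hB
    obtain ⟨y, hxy, rfl⟩ := mem_sensitiveBlocks.1 hB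
    exact (one_le_familyValue_mul hq hM hxy).trans
      (mul_le_mul_right (Finset.sum_le_sum fun i _ => min_le_left _ _) _)
  set M := familyValue f fun x i => (p x i : ℝ≥0∞)
  calc ((∑ B ∈ sensitiveBlocks f x, w B : ℝ≥0) : ℝ≥0∞)
      = ∑ B ∈ sensitiveBlocks f x, (w B : ℝ≥0∞) * 1 := by simp
    _ ≤ ∑ B ∈ sensitiveBlocks f x, (w B : ℝ≥0∞) * (M * ∑ i ∈ B, (p x i : ℝ≥0∞)) :=
        Finset.sum_le_sum fun B h => mul_le_mul_right (hB B h) _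
    _ = M * ∑ i, (p x i : ℝ≥0∞) *
          ((∑ B ∈ sensitiveBlocks f x with i ∈ B, w B : ℝ≥0) : ℝ≥0∞) := by
        simp only [ENNReal.ofNNReal_finsetSum, Finset.mul_sum, Finset.sum_filter]
        rw [Finset.sum_comm]
        refine Finset.sum_congr rfl fun B _ => ?_
        rw [← Finset.sum_subset (Finset.subset_univ B)]
        · refine Finset.sum_congr rfl fun i hi => ?_
          rw [if_pos hi]; ring
        · intro i _ hi
          simp [hi]
    _ ≤ M * ∑ i, (p x i : ℝ≥0∞) * 1 := by
        refine mul_le_mul_right (Finset.sum_le_sum fun i _ => mul_le_mul_right ?_ _) _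
        exact_mod_cast hw.2 i
    _ ≤ M := by
        simp only [mul_one]
        exact (mul_le_mul_right (hq x) _).trans (mul_one _).le

/-- Strong duality for the linear program of fractional block sensitivity, with the covering side
normalised to a probability distribution. -/
theorem exists_distribution_one_le_fbsAt_mul (f : S → H) (x : S) (hx : ∃ y, f x ≠ f y) :
    ∃ p : Fin n → ℝ≥0, ∑ i, p i = 1 ∧
      ∀ B ∈ sensitiveBlocks f x, 1 ≤ fbsAt f x * ((∑ i ∈ B, p i : ℝ≥0) : ℝ≥0∞) := by
  classical
  obtain ⟨y₀, hy₀⟩ := hx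
  have hne : ∀ B ∈ sensitiveBlocks f x, B.Nonempty := by
    intro B hB
    obtain ⟨y, hxy, rfl⟩ := mem_sensitiveBlocks.1 hB
    exact diff_nonempty_of_ne hxy
  have hmem := mem_sensitiveBlocks.2 ⟨y₀, hy₀, rfl⟩
  obtain ⟨i₀, -⟩ := hne _ hmem
  have : Nonempty (sensitiveBlocks f x) := ⟨⟨_, hmem⟩⟩
  have : Nonempty (Fin n) := ⟨i₀⟩
  -- In the block–position incidence game of value `c`, q/c is a packing of total 1/c, while `p`
  -- gives every block mass at least `c`.
  obtain ⟨q, hq, p, hp, c, hcp, hcq⟩ := Matrix.exists_optimal_strategies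
    (Matrix.of fun (B : sensitiveBlocks f x) (i : Fin n) => if i ∈ B.1 then (1 : ℝ) else 0)
  simp only [Matrix.of_apply, ite_mul, one_mul, zero_mul, mul_ite, mul_one, mul_zero] at hcp hcq
  have hc : 0 < c := by
    obtain ⟨B, -, hB⟩ : ∃ B ∈ Finset.univ, 0 < q B := by
      by_contra! h
      linarith [Finset.sum_nonpos h, hq.2]
    obtain ⟨i, hi⟩ := hne B.1 B.2
    refine lt_of_lt_of_le ?_ (hcq i)
    refine hB.trans_le ?_
    have := Finset.single_le_sum (f := fun B : sensitiveBlocks f x => if i ∈ B.1 then q B else 0)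
      (fun B _ => by split_ifs; exacts [hq.1 B, le_rfl]) (Finset.mem_univ B)
    simpa [hi] using this
  let w : Finset (Fin n) → ℝ≥0 := fun B =>
    if h : B ∈ sensitiveBlocks f x then (q ⟨B, h⟩ / c).toNNReal else 0
  have hw : ∀ B : sensitiveBlocks f x, ((w B.1 : ℝ≥0) : ℝ) = q B / c := by
    intro B
    simp only [w, B.2, dite_true]
    exact Real.coe_toNNReal _ (div_nonneg (hq.1 B) hc.le)
  have hcover : ∀ i : Fin n, ∑ B ∈ sensitiveBlocks f x with i ∈ B, w B ≤ 1 := by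
    intro i
    rw [← NNReal.coe_le_coe, Finset.sum_filter, ← Finset.sum_coe_sort]
    push_cast
    have : ∀ B : sensitiveBlocks f x, (((if i ∈ B.1 then w B.1 else 0 : ℝ≥0)) : ℝ)
        = (if i ∈ B.1 then q B else 0) / c := by
      intro B
      split_ifs
      · exact hw B
      · simp
    rw [Finset.sum_congr rfl fun B _ => this B, ← Finset.sum_div, div_le_one hc]
    exact hcq i
  have hpack : IsBlockPacking f x w := by
    refine ⟨fun B hB => ?_, hcover⟩
    obtain ⟨i, hi⟩ := hne B hB
    exact (Finset.single_le_sum (f := w) (fun _ _ => zero_le)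
      (Finset.mem_filter.2 ⟨hB, hi⟩)).trans (hcover i)
  have htot : ((∑ B ∈ sensitiveBlocks f x, w B : ℝ≥0) : ℝ) = 1 / c := by
    rw [← Finset.sum_coe_sort]
    push_cast
    rw [Finset.sum_congr rfl fun B _ => hw B, ← Finset.sum_div, hq.2]
  refine ⟨fun i => (p i).toNNReal, ?_, fun B hB => ?_⟩
  · rw [← NNReal.coe_inj]
    push_cast
    rw [← hp.2]
    exact Finset.sum_congr rfl fun i _ => Real.coe_toNNReal _ (hp.1 i)
  · refine le_trans ?_ (mul_le_mul_left (le_iSup₂_of_le w hpack le_rfl) _)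
    norm_cast
    rw [← NNReal.coe_le_coe, NNReal.coe_mul, htot]
    push_cast
    rw [Finset.sum_congr rfl fun i _ => Real.coe_toNNReal _ (hp.1 i), one_div,
      ← div_eq_inv_mul, one_le_div hc]
    have := hcp ⟨B, hB⟩
    rwa [← Finset.sum_filter, Finset.filter_mem_eq_inter, Finset.univ_inter] at this

/-- For a total function two distributions that are good for `x` and for `y` have a large overlap
on the positions where `x` and `y` differ: pass through a hybrid of `x` and `y`. -/
theorem MM_le_fbs_of_total (f : S → H) (hf : ∃ x y, f x ≠ f y) (hS : ∀ x, x ∈ S) :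
    MM f ≤ fbs f := by
  classical
  have hsens : ∀ x, ∃ y, f x ≠ f y := by
    obtain ⟨a, b, hab⟩ := hf
    intro x
    by_contra! h
    exact hab ((h a).symm.trans (h b))
  choose p hp hpB using fun x => exists_distribution_one_le_fbsAt_mul f x (hsens x)
  rw [MM_eq_iInf_familyValue]
  refine iInf₂_le_of_le p hp ?_
  refine iSup_le fun x => iSup₂_le fun y hxy => ?_
  refine ENNReal.div_le_of_le_mul ?_
  -- The hybrid, in S by totality, differs from either input only where that input has the smaller
  -- probability. Since f x ≠ f y, it is sensitive against one of them, and the mass of that block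
  -- is overlap.
  let z : S := ⟨fun i => if p x i ≤ p y i then y.1 i else x.1 i, hS _⟩
  by_cases hz : f x = f z
  · have hyz : f y ≠ f z := fun h => hxy (hz.trans h.symm)
    refine (hpB y _ (mem_sensitiveBlocks.2 ⟨z, hyz, rfl⟩)).trans ?_
    refine mul_le_mul' (le_iSup (fbsAt f) y) ?_
    rw [ENNReal.ofNNReal_finsetSum]
    have hsub : diff y z ⊆ diff x y := by
      intro i
      simp only [mem_diff, z]
      split_ifs with h
      · simp
      · exact fun h => h.symm
    refine le_trans (Finset.sum_le_sum fun i hi => ?_) (Finset.sum_le_sum_of_subset hsub)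
    rw [mem_diff] at hi
    have : ¬ p x i ≤ p y i := fun h => hi (by simp [z, h])
    exact le_min (ENNReal.coe_le_coe.2 (not_le.1 this).le) le_rfl
  · refine (hpB x _ (mem_sensitiveBlocks.2 ⟨z, hz, rfl⟩)).trans ?_
    refine mul_le_mul' (le_iSup (fbsAt f) x) ?_
    rw [ENNReal.ofNNReal_finsetSum]
    have hsub : diff x z ⊆ diff x y := by
      intro i
      simp only [mem_diff, z]
      split_ifs with h
      · exact id
      · simp
    refine le_trans (Finset.sum_le_sum fun i hi => ?_) (Finset.sum_le_sum_of_subset hsub)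
    rw [mem_diff] at hi
    have : p x i ≤ p y i := by
      by_contra h
      exact hi (by simp [z, h])
    exact le_min le_rfl (ENNReal.coe_le_coe.2 this)

end MinimaxTotal

end ClassicalAdversary

namespace ClassicalAdversary

/-! ### Kraft's inequality, its converse, and Shannon codes -/

section Kraft

theorem PrefixFree.uniquelyDecodable {A : Set (List Bool)} (hA : PrefixFree A) (hnil : [] ∉ A) :
    InformationTheory.UniquelyDecodable A := by
  intro L₁
  induction L₁ with
  | nil =>
    rintro (_ | ⟨w, L₂⟩) - h2 h
    · rfl
    · have : w = [] := by simp at h; exact h.1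
      exact absurd (h2 w (by simp)) (this ▸ hnil)
  | cons a L₁ ih =>
    rintro (_ | ⟨b, L₂⟩) h1 h2 h
    · have : a = [] := by simp at h; exact h.1
      exact absurd (h1 a (by simp)) (this ▸ hnil)
    · simp only [List.flatten_cons] at h
      have hab : a = b := by
        rcases List.prefix_or_prefix_of_prefix (List.prefix_append a L₁.flatten)
          (h ▸ List.prefix_append b L₂.flatten) with hp | hp
        · exact hA a (h1 a (by simp)) b (h2 b (by simp)) hp
        · exact (hA b (h2 b (by simp)) a (h1 a (by simp)) hp).symm
      subst hab
      rw [ih L₂ (fun w hw => h1 w (by simp [hw])) (fun w hw => h2 w (by simp [hw]))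
        (List.append_cancel_left h)]

/-- **Kraft's inequality** for prefix-free sets of binary strings. -/
theorem PrefixFree.sum_le_one {A : Finset (List Bool)} (hA : PrefixFree (A : Set (List Bool))) :
    ∑ w ∈ A, (2⁻¹ : ℝ≥0∞) ^ w.length ≤ 1 := by
  -- A code containing the empty word is not uniquely decodable, but prefix-freeness then leaves no
  -- other word.
  by_cases hnil : [] ∈ A
  · have : A = {[]} := by
      refine Finset.eq_singleton_iff_unique_mem.2 ⟨hnil, fun w hw => ?_⟩
      exact (hA [] hnil w hw List.nil_prefix).symm
    simp [this]
  · have h := InformationTheory.kraft_mcmillan_inequality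
      (hA.uniquelyDecodable (by simpa using hnil))
    have h' : ∑ w ∈ A, (2⁻¹ : ℝ≥0) ^ w.length ≤ 1 := by
      rw [← NNReal.coe_le_coe]
      push_cast
      simpa using h
    have h2 : (2⁻¹ : ℝ≥0∞) = ((2⁻¹ : ℝ≥0) : ℝ≥0∞) := by
      rw [ENNReal.coe_inv two_ne_zero]; rfl
    rw [h2]
    exact_mod_cast h'

theorem card_lists_length_eq (m : ℕ) :
    ∃ W : Finset (List Bool), (∀ w, w ∈ W ↔ w.length = m) ∧ W.card = 2 ^ m := by
  classical
  refine ⟨(Finset.univ : Finset (List.Vector Bool m)).map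
    ⟨List.Vector.toList, fun _ _ h => List.Vector.toList_injective h⟩, fun w => ?_, ?_⟩
  · simp only [Finset.mem_map, Finset.mem_univ, true_and]
    exact ⟨by rintro ⟨v, rfl⟩; exact v.toList_length, fun h => ⟨⟨w, h⟩, rfl⟩⟩
  · simp

/-- The converse of Kraft's inequality. -/
theorem exists_prefix_code {ι : Type*} (s : Finset ι) (l : ι → ℕ)
    (h : ∑ i ∈ s, (2⁻¹ : ℝ) ^ l i ≤ 1) :
    ∃ c : ι → List Bool, (∀ i ∈ s, (c i).length = l i) ∧
      ∀ i ∈ s, ∀ j ∈ s, c i <+: c j → i = j := by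
  classical
  induction s using Finset.induction_on_max_value l with
  | empty => exact ⟨fun _ => [], by simp, by simp⟩
  | insert a s ha hmax ih =>
    rw [Finset.sum_insert ha] at h
    obtain ⟨c, hlen, hpre⟩ := ih (by
      have : (0 : ℝ) ≤ 2⁻¹ ^ l a := by positivity
      linarith)
    choose W hW hcard using card_lists_length_eq
    -- Words are chosen by increasing length. Each earlier word rules out its 2^(l a - l i)
    -- extensions of length `l a`, and Kraft's sum leaves at least one word free.
    have hcount : ∑ i ∈ s, 2 ^ (l a - l i) < 2 ^ l a := by
      have hpow : ∀ k ≤ l a, (2 : ℝ) ^ l a * 2⁻¹ ^ k = 2 ^ (l a - k) := by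
        intro k hk
        rw [pow_sub₀ _ two_ne_zero hk, inv_pow]
      have := mul_le_mul_of_nonneg_left h (show (0 : ℝ) ≤ 2 ^ l a by positivity)
      rw [mul_add, Finset.mul_sum, hpow _ le_rfl,
        Finset.sum_congr rfl fun i hi => hpow (l i) (hmax i hi)] at this
      have h' : 1 + ∑ i ∈ s, 2 ^ (l a - l i) ≤ 2 ^ l a := by
        have : (1 + ∑ i ∈ s, 2 ^ (l a - l i) : ℝ) ≤ 2 ^ l a := by simpa using this
        exact_mod_cast this
      omega
    obtain ⟨w, hwW, hw⟩ : ∃ w ∈ W (l a),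
        w ∉ s.biUnion fun i => (W (l a - l i)).image (c i ++ ·) := by
      refine Finset.exists_mem_notMem_of_card_lt_card ?_
      rw [hcard]
      refine lt_of_le_of_lt (Finset.card_biUnion_le.trans (Finset.sum_le_sum fun i _ => ?_)) hcount
      exact Finset.card_image_le.trans (hcard _).le
    have hwl : w.length = l a := (hW _ _).1 hwW
    have hno : ∀ i ∈ s, ¬ c i <+: w := by
      rintro i hi ⟨t, ht⟩
      refine hw (Finset.mem_biUnion.2 ⟨i, hi, Finset.mem_image.2 ⟨t, (hW _ _).2 ?_, ht⟩⟩)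
      have := congrArg List.length ht
      rw [List.length_append, hlen i hi, hwl] at this
      omega
    have hca : ∀ i ∈ s, i ≠ a := fun i hi h => ha (h ▸ hi)
    refine ⟨Function.update c a w, fun i hi => ?_, fun i hi j hj hij => ?_⟩
    · rcases Finset.mem_insert.1 hi with rfl | hi
      · simpa using hwl
      · simpa [Function.update_of_ne (hca i hi)] using hlen i hi
    · rcases Finset.mem_insert.1 hi with rfl | hi' <;> rcases Finset.mem_insert.1 hj with rfl | hj'
      · rfl
      · rw [Function.update_self, Function.update_of_ne (hca j hj')] at hij
        have hle : (c j).length ≤ w.length := by rw [hlen j hj', hwl]; exact hmax j hj'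
        exact absurd (hij.eq_of_length_le hle ▸ List.prefix_rfl) (hno j hj')
      · rw [Function.update_self, Function.update_of_ne (hca i hi')] at hij
        exact absurd hij (hno i hi')
      · rw [Function.update_of_ne (hca i hi'), Function.update_of_ne (hca j hj')] at hij
        exact hpre i hi' j hj' hij

/-- Shannon's code: a subprobability distribution has a prefix code whose word lengths exceed
the logarithms of the inverse probabilities by at most one. -/
theorem exists_shannon_code {ι : Type*} [Fintype ι] (p : ι → ℝ≥0) (hp : ∑ i, p i ≤ 1) :
    ∃ c : ι → List Bool, (∀ i, p i ≠ 0 → p i ≤ 2 * 2⁻¹ ^ (c i).length) ∧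
      ∀ i j, p i ≠ 0 → p j ≠ 0 → c i <+: c j → i = j := by
  classical
  have hl : ∀ i, ∃ k : ℕ, p i ≠ 0 → (2⁻¹ : ℝ≥0) ^ k ≤ p i ∧ p i ≤ 2 * 2⁻¹ ^ k := by
    intro i
    by_cases h0 : p i = 0
    · exact ⟨0, fun h => absurd h0 h⟩
    have h1 : p i ≤ 1 := (Finset.single_le_sum (fun _ _ => zero_le) (Finset.mem_univ i)).trans hp
    obtain ⟨k, hk, hk'⟩ := exists_nat_pow_near_of_lt_one (pos_iff_ne_zero.2 h0) h1
      (show (0 : ℝ≥0) < 2⁻¹ by positivity) (by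
        rw [← NNReal.coe_lt_coe]; push_cast; norm_num)
    -- Here 2^(-(k+1)) < p i ≤ 2^(-k); rounding the length up preserves Kraft's sum and costs the
    -- factor 2.
    refine ⟨k + 1, fun _ => ⟨hk.le, hk'.trans (le_of_eq ?_)⟩⟩
    rw [pow_succ, mul_comm, mul_assoc, inv_mul_cancel₀ two_ne_zero, mul_one]
  choose l hl using hl
  have hsum : ∑ i with p i ≠ 0, (2⁻¹ : ℝ) ^ l i ≤ 1 := by
    have : ∑ i with p i ≠ 0, (2⁻¹ : ℝ≥0) ^ l i ≤ 1 :=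
      (Finset.sum_le_sum fun i hi => (hl i (Finset.mem_filter.1 hi).2).1).trans
        ((Finset.sum_le_sum_of_subset (Finset.subset_univ _)).trans hp)
    rw [← NNReal.coe_le_coe] at this
    push_cast at this
    exact this
  obtain ⟨c, hlen, hc⟩ := exists_prefix_code _ l hsum
  refine ⟨c, fun i hi => ?_, fun i j hi hj => hc i (by simpa using hi) j (by simpa using hj)⟩
  rw [hlen i (by simpa using hi)]
  exact (hl i hi).2

end Kraft

/-! ### Algorithmic probabilities as subprobabilities -/

section Complexity

theorem twoPowNeg_coe (m : ℕ) : twoPowNeg (m : ℕ∞) = 2⁻¹ ^ m := rfl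

theorem twoPowNeg_top : twoPowNeg ⊤ = 0 := rfl

theorem twoPowNeg_anti {a b : ℕ∞} (h : a ≤ b) : twoPowNeg b ≤ twoPowNeg a := by
  induction b using ENat.recTopCoe with
  | top => simp [twoPowNeg_top]
  | coe m =>
    lift a to ℕ using (h.trans_lt (ENat.natCast_lt_top m)).ne
    rw [twoPowNeg_coe, twoPowNeg_coe]
    exact pow_le_pow_right_of_le_one' (by simp) (by exact_mod_cast h)

theorem exists_shortest_program {U : List Bool → ℕ →. ℕ} {x y : ℕ}
    (h : prefixComplexity U x y ≠ ⊤) :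
    ∃ p, x ∈ U p y ∧ prefixComplexity U x y = (p.length : ℕ∞) := by
  have hne : ∃ p, x ∈ U p y := by
    by_contra! hno
    exact h (by simp [prefixComplexity, hno])
  have : Nonempty {p // x ∈ U p y} := nonempty_subtype.2 hne
  rw [prefixComplexity, iInf_subtype']
  obtain ⟨⟨p, hp⟩, hpe⟩ := ciInf_mem fun p : {p // x ∈ U p y} => (p.1.length : ℕ∞)
  exact ⟨p, hp, hpe.symm⟩

/-- The algorithmic probabilities given by a prefix machine form a subprobability distribution. -/
theorem IsPrefixMachine.sum_twoPowNeg_le_one {U : List Bool → ℕ →. ℕ} (hU : IsPrefixMachine U)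
    (s : Finset ℕ) (y : ℕ) : ∑ i ∈ s, twoPowNeg (prefixComplexity U i y) ≤ 1 := by
  classical
  choose! P hP hPlen using fun i (h : prefixComplexity U i y ≠ ⊤) => exists_shortest_program h
  have hsub : ∑ i ∈ s, twoPowNeg (prefixComplexity U i y)
      = ∑ i ∈ s with prefixComplexity U i y ≠ ⊤, (2⁻¹ : ℝ≥0∞) ^ (P i).length := by
    rw [Finset.sum_filter]
    refine Finset.sum_congr rfl fun i _ => ?_
    split_ifs with h
    · rw [hPlen i h, twoPowNeg_coe]
    · rw [not_not.1 h, twoPowNeg_top]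
  have hinj : Set.InjOn P ((s.filter fun i => prefixComplexity U i y ≠ ⊤ : Finset ℕ) : Set ℕ) := by
    intro i hi j hj hij
    have hi' := (Finset.mem_filter.1 hi).2
    have hj' := (Finset.mem_filter.1 hj).2
    exact Part.mem_unique (hP i hi') (hij ▸ hP j hj')
  rw [hsub, ← Finset.sum_image (f := fun w : List Bool => (2⁻¹ : ℝ≥0∞) ^ w.length) hinj]
  refine PrefixFree.sum_le_one ?_
  have hdom : ∀ p ∈ (s.filter fun i => prefixComplexity U i y ≠ ⊤).image P, (U p y).Dom := by
    intro p hp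
    obtain ⟨i, hi, rfl⟩ := Finset.mem_image.1 hp
    exact Part.dom_iff_mem.2 ⟨i, hP i (Finset.mem_filter.1 hi).2⟩
  exact fun p hp q hq => hU.prefixFree y p (hdom p hp) q (hdom q hq)

variable {n : ℕ} {G : Type u} {H : Type v} {S : Finset (Fin n → G)}

theorem sum_twoPowNeg_K_le_one [Encodable G] {U : List Bool → ℕ →. ℕ} (hU : IsPrefixMachine U)
    (x : S) (σ : List Bool) : ∑ i : Fin n, twoPowNeg (K U i x σ) ≤ 1 := by
  classical
  have := hU.sum_twoPowNeg_le_one ((Finset.univ : Finset (Fin n)).map Fin.valEmbedding)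
    (Encodable.encode ((List.ofFn fun j => Encodable.encode (x.1 j), σ) : List ℕ × List Bool))
  rwa [Finset.sum_map] at this

/-- A family of subprobability distributions is dominated by a family of distributions. -/
theorem MM_le_familyValue (f : S → H) (hf : ∃ x y, f x ≠ f y) (q : S → Fin n → ℝ≥0∞)
    (hq : ∀ x, ∑ i, q x i ≤ 1) : MM f ≤ familyValue f q := by
  classical
  obtain ⟨a, b, hab⟩ := hf
  obtain ⟨i₀, -⟩ := diff_nonempty_of_ne hab
  have hfin : ∀ x i, q x i ≠ ⊤ := fun x i =>
    (((Finset.single_le_sum (fun _ _ => zero_le) (Finset.mem_univ i)).trans (hq x)).trans_lt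
      ENNReal.one_lt_top).ne
  lift q to S → Fin n → ℝ≥0 using hfin
  have hq' : ∀ x, ∑ i, q x i ≤ 1 := fun x => by
    have := hq x
    dsimp only at this
    exact_mod_cast this
  -- The missing mass goes to an arbitrary position, which can only increase overlaps.
  let p : S → Fin n → ℝ≥0 := fun x i => q x i + if i = i₀ then 1 - ∑ j, q x j else 0
  have hp : ∀ x, ∑ i, p x i = 1 := fun x => by
    simp [p, Finset.sum_add_distrib, add_tsub_cancel_of_le (hq' x)]
  rw [MM_eq_iInf_familyValue]
  refine iInf₂_le_of_le p hp ?_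
  have := familyValue_le_mul (f := f) (q := fun x i => (q x i : ℝ≥0∞))
    (q' := fun x i => (p x i : ℝ≥0∞)) one_ne_zero ENNReal.one_ne_top
    fun x i => by rw [one_mul]; exact_mod_cast le_self_add
  rwa [one_mul] at this

theorem MM_le_KA [Encodable G] {U : List Bool → ℕ →. ℕ} (hU : IsPrefixMachine U) (f : S → H)
    (hf : ∃ x y, f x ≠ f y) : MM f ≤ KA U f := by
  rw [KA_eq_iInf_familyValue]
  exact le_iInf fun σ => MM_le_familyValue f hf _ fun x => sum_twoPowNeg_K_le_one hU x σ

end Complexity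

/-! ### A fixed prefix machine that realises any family of distributions -/

section TableMachine

/-- A finite table assigning outputs to pairs of an input and a program. -/
abbrev CodeTable := List ((List ℕ × List Bool) × ℕ)

/-- Look up a program in a table, provided that none of its proper prefixes is listed. -/
def CodeTable.eval (T : CodeTable) (xs : List ℕ) (P : List Bool) : Option ℕ :=
  ((List.range P.length).filterMap fun m => T.lookup (xs, P.take m)).head?.casesOn
    (T.lookup (xs, P)) fun _ => none

/-- The condition is a pair of an input and a string whose length is the code of a table. -/
def tableMachineOption (P : List Bool) (y : ℕ) : Option ℕ :=
  (Encodable.decode (α := List ℕ × List Bool) y).bind fun c =>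
    (Encodable.decode (α := CodeTable) c.2.length).bind fun T => T.eval c.1 P

/-- The prefix machine that looks up its program in a table given by the condition. -/
def tableMachine (P : List Bool) : ℕ →. ℕ := fun y => tableMachineOption P y

theorem primrec_codeTable_lookup :
    Primrec₂ fun (k : List ℕ × List Bool) (T : CodeTable) => T.lookup k := by
  convert Primrec.listLookup (α := List ℕ × List Bool) (β := ℕ)

theorem primrec_codeTable_eval :
    Primrec fun a : (CodeTable × List ℕ) × List Bool => a.1.1.eval a.1.2 a.2 := by
  unfold CodeTable.eval
  refine Primrec.option_casesOn (Primrec.list_head?.comp (Primrec.listFilterMap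
    (Primrec.list_range.comp (Primrec.list_length.comp Primrec.snd)) ?_)) ?_
    (Primrec.const none).to₂
  · exact primrec_codeTable_lookup.comp
      (Primrec.pair (Primrec.snd.comp (Primrec.fst.comp Primrec.fst))
        (Primrec.list_take.comp Primrec.snd (Primrec.snd.comp Primrec.fst)))
      (Primrec.fst.comp (Primrec.fst.comp Primrec.fst))
  · exact primrec_codeTable_lookup.comp
      (Primrec.pair (Primrec.snd.comp Primrec.fst) Primrec.snd)
      (Primrec.fst.comp Primrec.fst)

theorem primrec_tableMachineOption : Primrec₂ tableMachineOption := by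
  unfold tableMachineOption
  refine Primrec.option_bind (Primrec.decode.comp Primrec.snd) ?_
  refine Primrec.option_bind (Primrec.decode.comp
    (Primrec.list_length.comp (Primrec.snd.comp Primrec.snd))) ?_
  exact primrec_codeTable_eval.comp (Primrec.pair
    (Primrec.pair Primrec.snd (Primrec.fst.comp (Primrec.snd.comp Primrec.fst)))
    (Primrec.fst.comp (Primrec.fst.comp Primrec.fst)))

theorem CodeTable.eval_eq_some_iff {T : CodeTable} {xs : List ℕ} {P : List Bool} {i : ℕ} :
    T.eval xs P = some i ↔
      (∀ m < P.length, T.lookup (xs, P.take m) = none) ∧ T.lookup (xs, P) = some i := by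
  unfold CodeTable.eval
  rcases h : (List.range P.length).filterMap fun m => T.lookup (xs, P.take m) with _ | ⟨a, l⟩
  · have : ∀ m < P.length, T.lookup (xs, P.take m) = none := by
      rw [List.filterMap_eq_nil_iff] at h
      exact fun m hm => h m (List.mem_range.2 hm)
    simpa using fun _ => this
  · have : a ∈ (List.range P.length).filterMap fun m => T.lookup (xs, P.take m) := by simp [h]
    obtain ⟨m, hm, hma⟩ := List.mem_filterMap.1 this
    constructor
    · simp
    · rintro ⟨hno, -⟩
      rw [hno m (List.mem_range.1 hm)] at hma
      cases hma

/-- A condition may encode a table that is not prefix-free; rejecting programs with a listed proper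
prefix restores prefix-freeness for every condition. -/
theorem tableMachine_isPrefixMachine : IsPrefixMachine tableMachine where
  partrec := Computable.ofOption (f := fun a : List Bool × ℕ => tableMachineOption a.1 a.2)
    primrec_tableMachineOption.to_comp
  prefixFree y p hp q hq hpq := by
    obtain ⟨i, hi⟩ := Part.dom_iff_mem.1 hp
    obtain ⟨j, hj⟩ := Part.dom_iff_mem.1 hq
    simp only [tableMachine, tableMachineOption, Part.mem_ofOption, Option.mem_def,
      Option.bind_eq_some_iff] at hi hj
    obtain ⟨c, hc, T, hT, hi⟩ := hi
    obtain ⟨c', hc', T', hT', hj⟩ := hj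
    obtain rfl : c = c' := Option.some_injective _ (hc.symm.trans hc')
    obtain rfl : T = T' := Option.some_injective _ (hT.symm.trans hT')
    rw [CodeTable.eval_eq_some_iff] at hi hj
    refine hpq.eq_of_length (le_antisymm hpq.length_le (not_lt.1 fun hlt => ?_))
    have := hj.1 _ hlt
    rw [← List.prefix_iff_eq_take.1 hpq, hi.2] at this
    cases this

theorem lookup_eq_some_of_mem {α β : Type*} [BEq α] [LawfulBEq α] {l : List (α × β)} {a : α} {b : β}
    (h : (a, b) ∈ l) (huniq : ∀ b', (a, b') ∈ l → b' = b) : l.lookup a = some b := by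
  rcases hl : l.lookup a with _ | b'
  · rw [List.lookup_eq_none_iff] at hl
    simpa using hl _ h
  · obtain ⟨l₁, l₂, rfl, -⟩ := List.lookup_eq_some_iff.1 hl
    rw [huniq b' (by simp)]

variable {n : ℕ} {G : Type u} {H : Type v} {S : Finset (Fin n → G)}

/-- Some condition lets the table machine code the positions with Shannon's codes. -/
theorem exists_condition_for_family [Encodable G] (p : S → Fin n → ℝ≥0)
    (hp : ∀ x, ∑ i, p x i ≤ 1) :
    ∃ σ : List Bool, ∀ x i, (p x i : ℝ≥0∞) ≤ 2 * twoPowNeg (K tableMachine i x σ) := by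
  classical
  choose c hlen hc using fun x => exists_shannon_code (p x) (hp x)
  let word : S → List ℕ := fun x => List.ofFn fun j => Encodable.encode (x.1 j)
  have hword : Function.Injective word := by
    intro x y h
    have := List.ofFn_injective h
    exact Subtype.ext (funext fun j => Encodable.encode_injective (congrFun this j))
  let T : CodeTable := (Finset.univ.filter fun a : S × Fin n => p a.1 a.2 ≠ 0).toList.map
    fun a => ((word a.1, c a.1 a.2), (a.2 : ℕ))
  have hT : ∀ x P k, ((word x, P), k) ∈ T ↔ ∃ i, p x i ≠ 0 ∧ P = c x i ∧ k = (i : ℕ) := by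
    intro x P k
    simp only [T, List.mem_map, Finset.mem_toList, Finset.mem_filter, Finset.mem_univ, true_and,
      Prod.mk.injEq, Prod.exists]
    constructor
    · rintro ⟨x', i, hne, ⟨hx, rfl⟩, rfl⟩
      obtain rfl := hword hx
      exact ⟨i, hne, rfl, rfl⟩
    · rintro ⟨i, hne, rfl, rfl⟩
      exact ⟨x, i, hne, ⟨rfl, rfl⟩, rfl⟩
  -- The table is written in unary; the length of σ is irrelevant because KA does not charge for it.
  refine ⟨List.replicate (Encodable.encode T) true, fun x i => ?_⟩
  by_cases hi : p x i = 0
  · simp [hi]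
  have heval : T.eval (word x) (c x i) = some (i : ℕ) := by
    refine CodeTable.eval_eq_some_iff.2 ⟨fun m hm => ?_, ?_⟩
    · rw [List.lookup_eq_none_iff]
      rintro ⟨⟨xs, P⟩, k⟩ hmem
      rw [bne_iff_ne]
      rintro heq
      obtain ⟨rfl, rfl⟩ := Prod.mk.inj heq
      obtain ⟨j, hj, hjP, -⟩ := (hT _ _ _).1 hmem
      have hji : j = i := hc x j i hj hi (hjP ▸ List.take_prefix _ _)
      subst hji
      have := congrArg List.length hjP
      rw [List.length_take] at this
      omega
    · refine lookup_eq_some_of_mem ((hT _ _ _).2 ⟨i, hi, rfl, rfl⟩) fun k hk => ?_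
      obtain ⟨j, hj, hjP, rfl⟩ := (hT _ _ _).1 hk
      rw [hc x i j hi hj (hjP ▸ List.prefix_rfl)]
  have hK : K tableMachine i x (List.replicate (Encodable.encode T) true)
      ≤ ((c x i).length : ℕ∞) := by
    refine iInf₂_le (c x i) ?_
    simp only [tableMachine, tableMachineOption, Part.mem_ofOption, Encodable.encodek,
      Option.bind_some, List.length_replicate, Option.mem_def]
    exact heval
  calc (p x i : ℝ≥0∞) ≤ ((2 * 2⁻¹ ^ (c x i).length : ℝ≥0) : ℝ≥0∞) :=
        ENNReal.coe_le_coe.2 (hlen x i hi)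
    _ = 2 * twoPowNeg ((c x i).length : ℕ∞) := by
        rw [twoPowNeg_coe, ENNReal.coe_mul, ENNReal.coe_pow, ENNReal.coe_inv two_ne_zero]; rfl
    _ ≤ _ := mul_le_mul_right (twoPowNeg_anti hK) 2

theorem twoPowNeg_le_of_le_add {a b : ℕ∞} {d : ℕ} (h : a ≤ b + d) :
    twoPowNeg b ≤ 2 ^ d * twoPowNeg a := by
  induction b using ENat.recTopCoe with
  | top => simp [twoPowNeg_top]
  | coe m =>
    calc twoPowNeg (m : ℕ∞) = 2 ^ d * twoPowNeg ((m : ℕ∞) + d) := by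
          rw [← Nat.cast_add, twoPowNeg_coe, twoPowNeg_coe, pow_add, mul_left_comm, ← mul_pow,
            ENNReal.mul_inv_cancel two_ne_zero ENNReal.ofNat_ne_top, one_pow, mul_one]
      _ ≤ _ := mul_le_mul_right (twoPowNeg_anti h) _

/-- One factor 2 comes from rounding code lengths, and 2^d from replacing the table machine by `U`.
-/
theorem KA_le_mul_MM [Encodable G] {U : List Bool → ℕ →. ℕ} {d : ℕ}
    (hd : ∀ x y, prefixComplexity U x y ≤ prefixComplexity tableMachine x y + d) (f : S → H) :
    KA U f ≤ 2 ^ (d + 1) * MM f := by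
  have h0 : (2 ^ (d + 1) : ℝ≥0∞) ≠ 0 := by simp
  have ht : (2 ^ (d + 1) : ℝ≥0∞) ≠ ⊤ := by simp
  rw [MM_eq_iInf_familyValue, ENNReal.mul_iInf_of_ne h0 ht]
  refine le_iInf fun p => ?_
  rw [ENNReal.mul_iInf_of_ne h0 ht]
  refine le_iInf fun hp => ?_
  obtain ⟨σ, hσ⟩ := exists_condition_for_family p fun x => (hp x).le
  rw [KA_eq_iInf_familyValue]
  refine iInf_le_of_le σ (familyValue_le_mul h0 ht fun x i => (hσ x i).trans ?_)
  rw [pow_succ', mul_assoc]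
  exact mul_le_mul_right (twoPowNeg_le_of_le_add (hd _ _)) 2

end TableMachine

end ClassicalAdversary
theorem theorem1 :
    (∀ (n : ℕ) (G : Type u) (H : Type v) [Fintype G] [Fintype H] (S : Finset (Fin n → G))
        (f : S → H), (∃ x y, f x ≠ f y) →
      ClassicalAdversary.fbs f ≤ ClassicalAdversary.CA₁ f ∧
      ClassicalAdversary.CA₁ f ≤ ClassicalAdversary.CA f ∧
      ClassicalAdversary.CA f = ClassicalAdversary.WA f ∧
      ((∀ x, x ∈ S) → ClassicalAdversary.fbs f = ClassicalAdversary.MM f)) ∧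
    (∀ U : List Bool → ℕ →. ℕ, ClassicalAdversary.IsUniversalPrefixMachine U →
      ∃ C₁ C₂ C₃ : ℝ≥0,
        ∀ (n : ℕ) (G : Type u) (H : Type v) [Fintype G] [Encodable G] [Fintype H]
          (S : Finset (Fin n → G)) (f : S → H), (∃ x y, f x ≠ f y) →
        ClassicalAdversary.WA f ≤ C₁ * ClassicalAdversary.KA U f ∧
        ClassicalAdversary.MM f ≤ C₂ * ClassicalAdversary.KA U f ∧
        ClassicalAdversary.KA U f ≤ C₃ * ClassicalAdversary.MM f ∧
        ((∀ x, x ∈ S) →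
          ClassicalAdversary.WA f ≤ C₁ * ClassicalAdversary.fbs f ∧
          ClassicalAdversary.fbs f ≤ C₂ * ClassicalAdversary.KA U f ∧
          ClassicalAdversary.KA U f ≤ C₃ * ClassicalAdversary.fbs f)) := by
  open ClassicalAdversary in
  have htotal : ∀ {n : ℕ} {G : Type u} {H : Type v} {S : Finset (Fin n → G)} (f : S → H),
      (∃ x y, f x ≠ f y) → (∀ x, x ∈ S) → fbs f = MM f := fun f hf hS =>
    le_antisymm (fbs_le_MM f) (MM_le_fbs_of_total f hf hS)
  open ClassicalAdversary in
  refine ⟨fun n G H _ _ S f hf => ⟨fbs_le_CA₁ f, CA₁_le_CA f, CA_eq_WA f, htotal f hf⟩,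
    fun U hU => ?_⟩
  open ClassicalAdversary in
  -- The table machine is the same for all functions, so `d` depends only on `U`.
  obtain ⟨d, hd⟩ := hU.optimal _ tableMachine_isPrefixMachine
  refine ⟨2, 1, 2 ^ (d + 1), fun n G H _ _ _ S f hf => ?_⟩
  open ClassicalAdversary in
  have hWA : WA f ≤ 2 * MM f := CA_eq_WA f ▸ CA_le_two_mul_MM f
  have hMM := ClassicalAdversary.MM_le_KA hU.isPrefixMachine f hf
  have hKA := ClassicalAdversary.KA_le_mul_MM hd f
  simp only [ENNReal.coe_pow, ENNReal.coe_ofNat, ENNReal.coe_one, one_mul]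
  refine ⟨hWA.trans (mul_le_mul_right hMM 2), hMM, hKA, fun hS => ?_⟩
  rw [htotal f hf hS]
  exact ⟨hWA, hMM, hKA⟩
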